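/- A real matrix is totally non-negative if all its minors are non-negative. Let $\mathrm{HTN}$ denote the set of all $n\times n$ totally non-negative Hankel matrices, over all integers $n\ge 1$ (a Hankel matrix is one of the form $(s_{i+j})$ with $s_k$ real). Let $\mathcal{M}([0,\infty))$ denote the set of moment sequences $\left(\int x^k\,d\mu\right)_{k\ge 0}$ of non-negative measures $\mu$ on $\mathbb{R}$ that are supported on $[0,\infty)$ and have finite moments of all orders. An absolutely monotonic entire function is an entire function whose Taylor coefficients at every point of $(0,\infty)$ are real and non-negative. For a function $F:[0,\infty)\to\mathbb{R}$, the following are equivalent. 1. Applied entrywise, $F$ preserves positive semidefiniteness on $\mathrm{HTN}$; that is, for every $A=(a_{ij})\in\mathrm{HTN}$ the matrix $F[A]:=(F(a_{ij}))$ is positive semidefinite. 2. Applied entrywise, $F$ preserves the set $\mathrm{HTN}$; that is, $F[A]\in\mathrm{HTN}$ for every $A\in\mathrm{HTN}$. 3. Applied entrywise, $F$ sends $\mathcal{M}([0,\infty))$ to itself; that is, $(F(s_k))_{k\ge 0}\in\mathcal{M}([0,\infty))$ for every $(s_k)_{k\ge 0}\in\mathcal{M}([0,\infty))$. 4. The function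 $F$ agrees on $(0,\infty)$ with an absolutely monotonic entire function, and $0\le F(0)\le\lim_{\epsilon\to 0^+}F(\epsilon)$. -/

import Mathlib

open scoped NNReal Topology

/-- A real `m × n` matrix is totally non-negative if all its minors (determinants of square
submatrices, with rows and columns taken in increasing order) are non-negative. -/
def IsTotallyNonneg {m n : ℕ} (A : Matrix (Fin m) (Fin n) ℝ) : Prop :=
  ∀ (k : ℕ) (r : Fin k ↪o Fin m) (c : Fin k ↪o Fin n), 0 ≤ (A.submatrix r c).det

/-- A Hankel matrix: the entry at position `(i, j)` depends only on `i + j`. -/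
def IsHankel {n : ℕ} (A : Matrix (Fin n) (Fin n) ℝ) : Prop :=
  ∃ s : ℕ → ℝ, ∀ i j : Fin n, A i j = s ((i : ℕ) + (j : ℕ))

/-- The set of `n × n` totally non-negative Hankel matrices. -/
def HTN (n : ℕ) : Set (Matrix (Fin n) (Fin n) ℝ) :=
  {A | IsHankel A ∧ IsTotallyNonneg A}

/-- `μ` is a non-negative measure on `ℝ`, supported on `K`, with moments of all orders. -/
structure IsAdmissibleOn (μ : MeasureTheory.Measure ℝ) (K : Set ℝ) : Prop where
  supported : μ Kᶜ = 0
  integrable_pow : ∀ k : ℕ, MeasureTheory.Integrable (fun x : ℝ => x ^ k) μ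

/-- The set of moment sequences of admissible measures supported on `K`. -/
def momentSet (K : Set ℝ) : Set (ℕ → ℝ) :=
  {s | ∃ μ : MeasureTheory.Measure ℝ, IsAdmissibleOn μ K ∧ ∀ k : ℕ, s k = ∫ x, x ^ k ∂μ}

/-- An absolutely monotonic entire function: an entire function all of whose Taylor coefficients
(equivalently, derivatives of every order) at every point of `(0, ∞)` are real and
non-negative. -/
def IsAbsMonotonicEntire (g : ℂ → ℂ) : Prop :=
  Differentiable ℂ g ∧
    ∀ x : ℝ, 0 < x → ∀ n : ℕ,
      (iteratedDeriv n g (x : ℂ)).im = 0 ∧ 0 ≤ (iteratedDeriv n g (x : ℂ)).re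

/-- The entries of a totally non-negative matrix are its `1 × 1` minors, so non-negative. -/
theorem IsTotallyNonneg.entry_nonneg {m n : ℕ} {A : Matrix (Fin m) (Fin n) ℝ}
    (hA : IsTotallyNonneg A) (i : Fin m) (j : Fin n) : 0 ≤ A i j := by
  have h := hA 1 (OrderEmbedding.ofStrictMono (fun _ => i) (Subsingleton.strictMono _))
    (OrderEmbedding.ofStrictMono (fun _ => j) (Subsingleton.strictMono _))
  simpa using h

/-- Moments of measures supported on `[0, ∞)` are non-negative. -/
theorem momentSet.term_nonneg {s : ℕ → ℝ} (hs : s ∈ momentSet (Set.Ici 0)) (k : ℕ) :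
    0 ≤ s k := by
  obtain ⟨μ, hμ, h⟩ := hs
  rw [h k]
  apply MeasureTheory.integral_nonneg_of_ae
  have h0 : ∀ᵐ x ∂μ, x ∈ Set.Ici (0 : ℝ) := MeasureTheory.mem_ae_iff.mpr hμ.supported
  filter_upwards [h0] with x hx
  exact pow_nonneg hx k

/-- `F[A]`: the function `F : [0, ∞) → ℝ` applied to every entry of a matrix with non-negative
entries. -/
def entrywise {m n : ℕ} (F : ℝ≥0 → ℝ) (A : Matrix (Fin m) (Fin n) ℝ) (hA : ∀ i j, 0 ≤ A i j) :
    Matrix (Fin m) (Fin n) ℝ :=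
  Matrix.of fun i j => F ⟨A i j, hA i j⟩

/-- `F[s]`: the function `F : [0, ∞) → ℝ` applied to every term of a non-negative sequence. -/
def termwise (F : ℝ≥0 → ℝ) (s : ℕ → ℝ) (hs : ∀ k, 0 ≤ s k) : ℕ → ℝ :=
  fun k => F ⟨s k, hs k⟩

/-!
A Hankel matrix is totally non-negative if and only if it and its shift `(s_{i+j+1})` are both
positive semidefinite: by Fekete's criterion only minors with consecutive rows and columns matter,
at least after perturbing to the strictly positive case, and these are principal minors of one of
the two matrices. If `F` is a power series with non-negative coefficients, then `F[A]` is a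
non-negative combination of Schur powers of `A`, and `F[s]` one of moment sequences, powers of
`s` being moments of products of independent variables. A zero entry forces all entries `s_k`
except the first and the last to vanish, so a downward jump of `F` at `0` is harmless.

Conversely, only the moment sequences `a + b uᵏ` of two-atom measures are needed. The `2 × 2`
matrices show that `F` is non-decreasing. A one-sided mollification makes `F` smooth while keeping
the hypothesis; then Loewner's argument (pairing the Hankel matrix of `F (a + b uᵏ)` with a vector
for which the terms of order less than `m` in `b` cancel) gives `F⁽ᵐ⁾ (a) ≥ 0`, Bernstein's theorem
turns the mollifications into power series with non-negative coefficients, and these converge along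
a subsequence.
-/

section PosSemidefClosure

open MeasureTheory
open scoped ComplexOrder

variable {n ι 𝕜 : Type*} [RCLike 𝕜]

theorem posSemidef_of_hasSum [Finite n] {A : ι → Matrix n n 𝕜} {B : Matrix n n 𝕜}
    (hA : ∀ k, (A k).PosSemidef) (hB : ∀ i j, HasSum (fun k ↦ A k i j) (B i j)) :
    B.PosSemidef := by
  have := Fintype.ofFinite n
  refine .of_dotProduct_mulVec_nonneg (Matrix.IsHermitian.ext fun i j ↦ ?_) fun x ↦ ?_
  · refine (hB j i).star.unique ?_
    simpa only [(hA _).isHermitian.apply] using hB i j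
  · have hform : HasSum (fun k ↦ star x ⬝ᵥ (A k).mulVec x) (star x ⬝ᵥ B.mulVec x) :=
      hasSum_sum fun i _ ↦ (hasSum_sum fun j _ ↦ (hB i j).mul_right _).mul_left _
    exact hform.nonneg fun k ↦ (hA k).dotProduct_mulVec_nonneg x

theorem posSemidef_integral [Finite n] {Ω : Type*} [MeasurableSpace Ω] {μ : Measure Ω}
    {A : Ω → Matrix n n ℝ} (hA : ∀ ω, (A ω).PosSemidef)
    (hint : ∀ i j, Integrable (fun ω ↦ A ω i j) μ) :
    (Matrix.of fun i j ↦ ∫ ω, A ω i j ∂μ).PosSemidef := by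
  have := Fintype.ofFinite n
  refine .of_dotProduct_mulVec_nonneg (Matrix.IsHermitian.ext fun i j ↦ ?_) fun x ↦ ?_
  · simp only [Matrix.of_apply, star_trivial]
    exact integral_congr_ae (.of_forall fun ω ↦ (hA ω).isHermitian.apply i j)
  · have hrow (i : n) : Integrable (fun ω ↦ (A ω).mulVec x i) μ :=
      integrable_finsetSum _ fun j _ ↦ (hint i j).mul_const _
    have hform : star x ⬝ᵥ (Matrix.of fun i j ↦ ∫ ω, A ω i j ∂μ).mulVec x =
        ∫ ω, star x ⬝ᵥ (A ω).mulVec x ∂μ := by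
      simp only [dotProduct]
      rw [integral_finsetSum _ fun i _ ↦ (hrow i).const_mul _]
      refine Finset.sum_congr rfl fun i _ ↦ ?_
      simp only [integral_const_mul, Matrix.mulVec, dotProduct, Matrix.of_apply]
      rw [integral_finsetSum _ fun j _ ↦ (hint i j).mul_const _]
      simp only [integral_mul_const]
    rw [hform]
    exact integral_nonneg fun ω ↦ (hA ω).dotProduct_mulVec_nonneg x

theorem posSemidef_map_pow [Finite n] {A : Matrix n n 𝕜} (hA : A.PosSemidef) (k : ℕ) :
    (A.map (· ^ k)).PosSemidef := by
  have := Fintype.ofFinite n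
  induction k with
  | zero =>
    convert Matrix.posSemidef_vecMulVec_self_star (1 : n → 𝕜) using 1
    ext i j
    simp [Matrix.vecMulVec_apply]
  | succ k ih =>
    convert ih.hadamard hA using 1
    ext i j
    simp [pow_succ]

theorem posSemidef_map_of_hasSum [Finite n] {A : Matrix n n ℝ} (hA : A.PosSemidef) {g : ℝ → ℝ}
    {c : ℕ → ℝ} (hc : ∀ k, 0 ≤ c k)
    (hg : ∀ i j, HasSum (fun k ↦ c k * A i j ^ k) (g (A i j))) : (A.map g).PosSemidef :=
  posSemidef_of_hasSum (fun k ↦ (posSemidef_map_pow hA k).smul (hc k)) hg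

theorem posSemidef_map_of_isDiag [Finite n] {A : Matrix n n ℝ} (hA : A.IsDiag) {g : ℝ → ℝ}
    (hg0 : 0 ≤ g 0) (hg : ∀ i, g 0 ≤ g (A i i)) : (A.map g).PosSemidef := by
  classical
  have := Fintype.ofFinite n
  have hconst : (Matrix.of fun _ _ : n ↦ g 0).PosSemidef := by
    convert (Matrix.posSemidef_vecMulVec_self_star (1 : n → ℝ)).smul hg0 using 1
    ext i j
    simp
  convert hconst.add (Matrix.PosSemidef.diagonal fun i ↦ sub_nonneg.2 (hg i)) using 1
  ext i j
  obtain rfl | hij := eq_or_ne i j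
  · simp
  · simp [hij, hA hij]

theorem one_le_det_one_add_smul_of_minors_nonneg {R : Type*} [CommRing R] [PartialOrder R]
    [IsOrderedRing R] [Fintype n] [DecidableEq n] {A : Matrix n n R}
    (hA : ∀ s : Finset n, 0 ≤ (A.submatrix ((↑) : s → n) (↑)).det) {t : R} (ht : 0 ≤ t) :
    1 ≤ (1 + t • A).det := by
  set P : Polynomial R := (1 + (Polynomial.X : Polynomial R) • A.map Polynomial.C).det with hP
  have heval : P.eval t = (1 + t • A).det := by
    rw [hP, ← Polynomial.coe_evalRingHom, RingHom.map_det]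
    congr 1
    ext i j
    by_cases hij : i = j <;> simp [hij, mul_comm t]
  have hcoeff (k : ℕ) : 0 ≤ P.coeff k := by
    rw [hP, Matrix.coeff_det_one_add_X_smul_eq_sum_minors]
    exact Finset.sum_nonneg fun s _ ↦ hA s
  have hcoeff_zero : P.coeff 0 = 1 := by
    simp [hP, Matrix.coeff_det_one_add_X_smul_eq_sum_minors]
  calc 1 = P.coeff 0 * t ^ 0 := by rw [hcoeff_zero, pow_zero, mul_one]
    _ ≤ ∑ k ∈ Finset.range (P.natDegree + 1), P.coeff k * t ^ k :=
      Finset.single_le_sum (fun k _ ↦ mul_nonneg (hcoeff k) (pow_nonneg ht k))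
        (Finset.mem_range.2 P.natDegree.succ_pos)
    _ = (1 + t • A).det := by rw [← Polynomial.eval_eq_sum_range, heval]

-- For an eigenvalue `λ < 0`, the determinant of `1 + t A` would vanish at `t = -1 / λ`.
theorem posSemidef_of_minors_nonneg [Finite n] [DecidableEq n] {A : Matrix n n 𝕜}
    (hA : A.IsHermitian) (hminors : ∀ s : Finset n, 0 ≤ (A.submatrix ((↑) : s → n) (↑)).det) :
    A.PosSemidef := by
  have := Fintype.ofFinite n
  refine hA.posSemidef_iff_eigenvalues_nonneg.2 fun i ↦ ?_
  by_contra hneg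
  have hlt : hA.eigenvalues i < 0 := not_le.1 hneg
  set t : 𝕜 := ((-(hA.eigenvalues i)⁻¹ : ℝ) : 𝕜) with ht
  have hdet : 1 ≤ (1 + t • A).det :=
    one_le_det_one_add_smul_of_minors_nonneg hminors
      (RCLike.ofReal_nonneg.2 (neg_nonneg.2 (inv_nonpos.2 hlt.le)))
  have hker : (1 + t • A).mulVec (hA.eigenvectorBasis i) = 0 := by
    have htl : t * (hA.eigenvalues i : 𝕜) = -1 := by
      rw [ht, ← RCLike.ofReal_mul, neg_mul, inv_mul_cancel₀ hlt.ne]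
      simp
    rw [Matrix.add_mulVec, Matrix.one_mulVec, Matrix.smul_mulVec, hA.mulVec_eigenvectorBasis,
      RCLike.real_smul_eq_coe_smul (K := 𝕜), smul_smul, htl, neg_one_smul, add_neg_cancel]
  have hne : (hA.eigenvectorBasis i).ofLp ≠ 0 := fun h ↦
    hA.eigenvectorBasis.orthonormal.ne_zero i (WithLp.ofLp_injective 2 h)
  rw [Matrix.exists_mulVec_eq_zero_iff.1 ⟨_, hne, hker⟩] at hdet
  exact zero_lt_one.not_ge hdet

end PosSemidefClosure

section Fekete

variable {K : Type*} [Field K]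

theorem det_eq_prod_mul_det_sub {k : ℕ} (V : Matrix (Fin (k + 1)) (Fin (k + 1)) K)
    (hV : ∀ a, V a 0 ≠ 0) :
    V.det = (∏ a, V a 0) * (Matrix.of fun a b : Fin k ↦
      V a.succ b.succ / V a.succ 0 - V a.castSucc b.succ / V a.castSucc 0).det := by
  set U : Matrix (Fin (k + 1)) (Fin (k + 1)) K := Matrix.of fun a b ↦ V a b / V a 0 with hU
  set B : Matrix (Fin (k + 1)) (Fin (k + 1)) K :=
    Matrix.of fun a b ↦ Fin.cases (U 0 b) (fun i ↦ U i.succ b - U i.castSucc b) a with hB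
  have hU_zero (a) : U a 0 = 1 := by simp [hU, hV a]
  have hVU : V.det = (∏ a, V a 0) * U.det := by
    rw [← Matrix.det_mul_column]
    congr 1
    ext a b
    simp [hU, mul_div_cancel₀ _ (hV a)]
  have hUB : U.det = B.det :=
    Matrix.det_eq_of_forall_row_eq_smul_add_pred (fun _ ↦ 1) (by simp [hB]) (by simp [hB])
  have hB_zero : B 0 0 = 1 := by simp [hB, hU_zero]
  have hB_succ (i : Fin k) : B i.succ 0 = 0 := by simp [hB, hU_zero]
  rw [hVU, hUB, Matrix.det_succ_column_zero, Fin.sum_univ_succ]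
  simp only [hB_zero, hB_succ, Fin.val_zero, pow_zero, mul_one, one_mul, mul_zero, zero_mul,
    Finset.sum_const_zero, add_zero]
  congr 1

/-- The matrix left after scaling the rows of `V` so that its first column is constant, taking
differences of consecutive rows and deleting the first column. Its minors control those of `V`. -/
def ratioDiff (V : Matrix ℕ ℕ K) : Matrix ℕ ℕ K :=
  Matrix.of fun i j ↦ V (i + 1) (j + 1) / V (i + 1) 0 - V i (j + 1) / V i 0

theorem sum_Ico_ratioDiff (V : Matrix ℕ ℕ K) {p q : ℕ} (hpq : p ≤ q) (j : ℕ) :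
    ∑ i ∈ Finset.Ico p q, ratioDiff V i j = V q (j + 1) / V q 0 - V p (j + 1) / V p 0 :=
  Finset.sum_Ico_sub (fun i ↦ V i (j + 1) / V i 0) hpq

theorem det_submatrix_eq_prod_mul_sum_det_ratioDiff (V : Matrix ℕ ℕ K) {k : ℕ}
    {r : Fin (k + 1) → ℕ} (hr : Monotone r) (hV : ∀ a, V (r a) 0 ≠ 0) :
    (V.submatrix r Fin.val).det = (∏ a, V (r a) 0) *
      ∑ f ∈ Fintype.piFinset fun a : Fin k ↦ Finset.Ico (r a.castSucc) (r a.succ),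
        ((ratioDiff V).submatrix f Fin.val).det := by
  have hrows : (Matrix.of fun a b : Fin k ↦
      V (r a.succ) (b + 1) / V (r a.succ) 0 - V (r a.castSucc) (b + 1) / V (r a.castSucc) 0) =
      fun a ↦ ∑ i ∈ Finset.Ico (r a.castSucc) (r a.succ), fun b : Fin k ↦ ratioDiff V i b := by
    ext a b
    rw [Finset.sum_apply, sum_Ico_ratioDiff V (hr (Fin.castSucc_lt_succ).le), Matrix.of_apply]
  rw [det_eq_prod_mul_det_sub _ (by simpa using hV)]
  congr 1
  exact (congrArg Matrix.det hrows).trans <|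
    (Matrix.detRowAlternating (R := K) (n := Fin k)).toMultilinearMap.map_sum_finset
      (fun _ i b ↦ ratioDiff V i b) fun a ↦ Finset.Ico (r a.castSucc) (r a.succ)

variable [LinearOrder K] [IsStrictOrderedRing K]

theorem det_ratioDiff_pos_of_consecutive {V : Matrix ℕ ℕ K} {i m : ℕ}
    (hV : ∀ a ≤ m, 0 < V (i + a) 0)
    (hdet : 0 < (V.submatrix (fun a : Fin (m + 1) ↦ i + a) Fin.val).det) :
    0 < ((ratioDiff V).submatrix (fun a : Fin m ↦ i + a) Fin.val).det := by
  have hfirst (a : Fin (m + 1)) : 0 < V (i + a) 0 := hV a (by omega)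
  rw [det_submatrix_eq_prod_mul_sum_det_ratioDiff V (fun a b hab ↦ by simpa using hab)
    fun a ↦ (hfirst a).ne'] at hdet
  simp only [Fin.val_castSucc, Fin.val_succ, ← add_assoc, Nat.Ico_succ_singleton,
    Fintype.piFinset_singleton, Finset.sum_singleton] at hdet
  exact pos_of_mul_pos_right hdet (Finset.prod_nonneg fun a _ ↦ (hfirst a).le)

theorem det_pos_of_consecutive_rows {k N : ℕ} {V : Matrix ℕ ℕ K}
    (hV : ∀ m ≤ k, ∀ i, i + m ≤ N → 0 < (V.submatrix (fun a : Fin m ↦ i + a) Fin.val).det)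
    {r : Fin k → ℕ} (hr : StrictMono r) (hrN : ∀ a, r a < N) :
    0 < (V.submatrix r Fin.val).det := by
  induction k generalizing N V with
  | zero => simp
  | succ k ih =>
    have hfirst (i) (hi : i < N) : 0 < V i 0 := by simpa using hV 1 (by omega) i hi
    rw [det_submatrix_eq_prod_mul_sum_det_ratioDiff V hr.monotone fun a ↦ (hfirst _ (hrN a)).ne']
    refine mul_pos (Finset.prod_pos fun a _ ↦ hfirst _ (hrN a)) (Finset.sum_pos ?_
      ⟨fun a ↦ r a.castSucc, by simp [Fintype.mem_piFinset, hr Fin.castSucc_lt_succ]⟩)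
    simp only [Fintype.mem_piFinset, Finset.mem_Ico]
    intro f hf
    refine ih (N := N - 1) (fun m hm i hi ↦ ?_) (fun a b hab ↦ ?_) fun a ↦ ?_
    · obtain rfl | hm0 := m.eq_zero_or_pos
      · simp
      · exact det_ratioDiff_pos_of_consecutive (fun a ha ↦ hfirst _ (by omega))
          (hV (m + 1) (by omega) i (by omega))
    · exact (hf a).2.trans_le ((hr.monotone (Fin.succ_le_castSucc_iff.2 hab)).trans (hf b).1)
    · have := (hf a).2
      have := hrN a.succ
      omega

theorem det_pos_of_consecutive {M N : ℕ} {V : Matrix ℕ ℕ K}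
    (hV : ∀ m i j, i + m ≤ M → j + m ≤ N →
      0 < (V.submatrix (fun a : Fin m ↦ i + a) fun b : Fin m ↦ j + b).det)
    {k : ℕ} {r c : Fin k → ℕ} (hr : StrictMono r) (hc : StrictMono c)
    (hrM : ∀ a, r a < M) (hcN : ∀ a, c a < N) : 0 < (V.submatrix r c).det := by
  have hrows {m j : ℕ} {r : Fin m → ℕ} (hr : StrictMono r) (hrM : ∀ a, r a < M)
      (hj : j + m ≤ N) : 0 < (V.submatrix r fun b : Fin m ↦ j + b).det :=
    det_pos_of_consecutive_rows (V := V.submatrix id (j + ·))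
      (fun m' hm' i hi ↦ hV m' i j hi (by omega)) hr hrM
  set W : Matrix ℕ ℕ K := Matrix.of fun j b ↦ if hb : b < k then V (r ⟨b, hb⟩) j else 0 with hW
  have hWt {m : ℕ} (hm : m ≤ k) (d : Fin m → ℕ) :
      W.submatrix d Fin.val = (V.submatrix (fun a ↦ r (Fin.castLE hm a)) d).transpose := by
    ext a b
    simp [hW, b.is_lt.trans_le hm, Fin.castLE]
  have hcols : 0 < (W.submatrix c Fin.val).det := by
    refine det_pos_of_consecutive_rows (fun m hm j hj ↦ ?_) hc hcN
    rw [hWt hm, Matrix.det_transpose]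
    exact hrows (hr.comp (Fin.strictMono_castLE hm)) (fun _ ↦ hrM _) hj
  rwa [hWt le_rfl, Matrix.det_transpose] at hcols

end Fekete

section Hankel

/-- The Hankel matrix `(s_{i+j})` of size `n`. -/
def hankel {α : Type*} (s : ℕ → α) (n : ℕ) : Matrix (Fin n) (Fin n) α :=
  Matrix.of fun i j ↦ s (i + j)

theorem hankel_apply {α : Type*} (s : ℕ → α) (n : ℕ) (i j : Fin n) :
    hankel s n i j = s (i + j) := rfl

theorem hankel_map {α β : Type*} (s : ℕ → α) (n : ℕ) (g : α → β) :
    (hankel s n).map g = hankel (g ∘ s) n := rfl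

variable {s : ℕ → ℝ} {n : ℕ}

theorem hankel_isHermitian (s : ℕ → ℝ) (n : ℕ) : (hankel s n).IsHermitian := by
  ext i j
  simp [hankel_apply, add_comm]

/-- The order embedding `a ↦ p + a` of `Fin m` into `Fin n`, selecting consecutive rows. -/
def shiftEmb {m n : ℕ} (p : ℕ) (h : p + m ≤ n) : Fin m ↪o Fin n :=
  (Fin.natAddOrderEmb p).trans (Fin.castLEOrderEmb h)

@[simp]
theorem shiftEmb_val {m n : ℕ} (p : ℕ) (h : p + m ≤ n) (a : Fin m) :
    (shiftEmb p h a : ℕ) = p + a := rfl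

theorem hankel_submatrix_shiftEmb {m p q : ℕ} (s : ℕ → ℝ) (hp : p + m ≤ n) (hq : q + m ≤ n) :
    (hankel s n).submatrix (shiftEmb p hp) (shiftEmb q hq) = hankel (fun k ↦ s (p + q + k)) m := by
  ext a b
  simp only [Matrix.submatrix_apply, hankel_apply, shiftEmb_val]
  congr 1
  omega

theorem hankel_shift_posDef {m p : ℕ} (h : (hankel s n).PosDef) (hp : p + m ≤ n) :
    (hankel (fun k ↦ s (p + p + k)) m).PosDef := by
  rw [← hankel_submatrix_shiftEmb s hp hp]
  exact h.submatrix (shiftEmb p hp).injective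

theorem hankel_shift_det_pos (h : (hankel s n).PosDef)
    (h' : (hankel (fun k ↦ s (k + 1)) (n - 1)).PosDef) {m i j : ℕ} (hi : i + m ≤ n)
    (hj : j + m ≤ n) : 0 < (hankel (fun k ↦ s (i + j + k)) m).det := by
  obtain rfl | _ := m.eq_zero_or_pos
  · simp
  obtain ⟨p, hp⟩ | ⟨p, hp⟩ := (i + j).even_or_odd
  · rw [hp]
    exact (hankel_shift_posDef h (p := p) (by omega)).det_pos
  · have hshift := (hankel_shift_posDef h' (m := m) (p := p) (by omega)).det_pos
    rwa [show (fun k ↦ s (p + p + k + 1)) = fun k ↦ s (i + j + k) by ext k; congr 1; omega]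
      at hshift

theorem hankel_minor_pos (h : (hankel s n).PosDef)
    (h' : (hankel (fun k ↦ s (k + 1)) (n - 1)).PosDef) {k : ℕ} (r c : Fin k ↪o Fin n) :
    0 < ((hankel s n).submatrix r c).det := by
  refine det_pos_of_consecutive (V := Matrix.of fun i j ↦ s (i + j)) (fun m i j hi hj ↦ ?_)
    (r := Fin.val ∘ r) (c := Fin.val ∘ c) r.strictMono c.strictMono (fun a ↦ (r a).is_lt)
    fun a ↦ (c a).is_lt
  have hcons := hankel_shift_det_pos h h' hi hj
  rwa [← hankel_submatrix_shiftEmb s hi hj] at hcons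

theorem hankel_sum_mul_pow_posDef {w x : Fin n → ℝ} (hw : ∀ l, 0 < w l)
    (hx : Function.Injective x) : (hankel (fun k ↦ ∑ l, w l * x l ^ k) n).PosDef := by
  have hV : Function.Injective (Matrix.vandermonde x).mulVec :=
    Matrix.mulVec_injective_of_isUnit <| (Matrix.isUnit_iff_isUnit_det _).2
      (isUnit_iff_ne_zero.2 (Matrix.det_vandermonde_ne_zero_iff.2 hx))
  convert (Matrix.PosDef.diagonal hw).conjTranspose_mul_mul_same hV using 1
  ext i j
  rw [Matrix.mul_assoc, Matrix.mul_apply]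
  simp only [hankel_apply, Matrix.diagonal_mul, Matrix.conjTranspose_apply,
    Matrix.vandermonde_apply, star_trivial, pow_add]
  exact Finset.sum_congr rfl fun l _ ↦ by ring

theorem exists_hankel_posDef (n : ℕ) : ∃ t : ℕ → ℝ,
    (hankel t n).PosDef ∧ (hankel (fun k ↦ t (k + 1)) (n - 1)).PosDef := by
  have hinj : Function.Injective fun l : Fin n ↦ (l : ℝ) + 1 := fun a b hab ↦
    Fin.ext (by simpa using hab)
  refine ⟨fun k ↦ ∑ l : Fin n, 1 * ((l : ℝ) + 1) ^ k,
    hankel_sum_mul_pow_posDef (fun _ ↦ one_pos) hinj, ?_⟩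
  have hshift := hankel_sum_mul_pow_posDef (w := fun l : Fin n ↦ (l : ℝ) + 1)
    (fun l ↦ by positivity) hinj
  convert hshift.submatrix (Fin.castLE_injective (n.sub_le 1)) using 1
  ext i j
  simp [hankel_apply, pow_succ']

theorem hankel_isTotallyNonneg (h : (hankel s n).PosSemidef)
    (h' : (hankel (fun k ↦ s (k + 1)) (n - 1)).PosSemidef) : IsTotallyNonneg (hankel s n) := by
  intro k r c
  obtain ⟨t, ht, ht'⟩ := exists_hankel_posDef n
  have hpos (ε : ℝ) (hε : 0 < ε) :
      0 < ((hankel (fun k ↦ s k + ε * t k) n).submatrix r c).det :=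
    hankel_minor_pos (s := fun k ↦ s k + ε * t k) (Matrix.PosDef.posSemidef_add h (ht.smul hε))
      (Matrix.PosDef.posSemidef_add h' (ht'.smul hε)) r c
  have hcont : Continuous fun ε : ℝ ↦
      ((hankel (fun k ↦ s k + ε * t k) n).submatrix r c).det := by
    refine Continuous.matrix_det (continuous_matrix fun i j ↦ ?_)
    simp only [Matrix.submatrix_apply, hankel_apply]
    fun_prop
  have hlim := (hcont.tendsto 0).mono_left (nhdsWithin_le_nhds (s := Set.Ioi 0))
  simp only [zero_mul, add_zero] at hlim
  exact ge_of_tendsto hlim (eventually_mem_nhdsWithin.mono fun ε hε ↦ (hpos ε hε).le)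

end Hankel

section TotallyNonnegHankel

variable {s : ℕ → ℝ} {n : ℕ}

theorem IsTotallyNonneg.submatrix {m n m' n' : ℕ} {A : Matrix (Fin m) (Fin n) ℝ}
    (hA : IsTotallyNonneg A) (e : Fin m' ↪o Fin m) (f : Fin n' ↪o Fin n) :
    IsTotallyNonneg (A.submatrix e f) := fun k r c ↦ hA k (r.trans e) (c.trans f)

theorem IsTotallyNonneg.posSemidef {A : Matrix (Fin n) (Fin n) ℝ} (hA : IsTotallyNonneg A)
    (hherm : A.IsHermitian) : A.PosSemidef := by
  refine posSemidef_of_minors_nonneg hherm fun s ↦ ?_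
  rw [← Matrix.det_submatrix_equiv_self (s.orderIsoOfFin rfl).toEquiv]
  exact hA s.card (s.orderEmbOfFin rfl) (s.orderEmbOfFin rfl)

theorem IsTotallyNonneg.hankel_succ_posSemidef (h : IsTotallyNonneg (hankel s n)) :
    (hankel (fun k ↦ s (k + 1)) (n - 1)).PosSemidef := by
  obtain _ | n := n
  · exact .of_dotProduct_mulVec_nonneg (hankel_isHermitian _ _) fun x ↦ by simp
  · have hsub := h.submatrix (shiftEmb (m := n) 0 (by omega)) (shiftEmb (m := n) 1 (by omega))
    rw [hankel_submatrix_shiftEmb] at hsub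
    simp only [zero_add, add_comm 1] at hsub
    exact hsub.posSemidef (hankel_isHermitian _ _)

theorem hankel_mem_HTN_iff : hankel s n ∈ HTN n ↔
    (hankel s n).PosSemidef ∧ (hankel (fun k ↦ s (k + 1)) (n - 1)).PosSemidef :=
  ⟨fun h ↦ ⟨h.2.posSemidef (hankel_isHermitian s n), h.2.hankel_succ_posSemidef⟩,
    fun h ↦ ⟨⟨s, hankel_apply s n⟩, hankel_isTotallyNonneg h.1 h.2⟩⟩

theorem exists_eq_hankel_of_mem_HTN {A : Matrix (Fin n) (Fin n) ℝ} (hA : A ∈ HTN n) :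
    ∃ s, A = hankel s n :=
  hA.1.imp fun _ hs ↦ Matrix.ext hs

theorem posSemidef_of_mem_HTN {A : Matrix (Fin n) (Fin n) ℝ} (hA : A ∈ HTN n) :
    A.PosSemidef := by
  obtain ⟨s, rfl⟩ := exists_eq_hankel_of_mem_HTN hA
  exact (hankel_mem_HTN_iff.1 hA).1

theorem exists_add_eq_of_add_two_mul_le {i m n : ℕ} (h : i + 2 * m ≤ 2 * n) :
    ∃ p q, p + m ≤ n ∧ q + m ≤ n ∧ p + q = i :=
  ⟨min i (n - m), i - min i (n - m), by omega, by omega, by omega⟩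

theorem IsTotallyNonneg.hankel_minor_nonneg (h : IsTotallyNonneg (hankel s n)) {i m : ℕ}
    (hi : i + 2 * m ≤ 2 * n) : 0 ≤ (hankel (fun k ↦ s (i + k)) m).det := by
  obtain ⟨p, q, hp, hq, rfl⟩ := exists_add_eq_of_add_two_mul_le hi
  rw [← hankel_submatrix_shiftEmb s hp hq]
  exact h m _ _

theorem IsTotallyNonneg.hankel_nonneg (h : IsTotallyNonneg (hankel s n)) {i : ℕ}
    (hi : i + 2 ≤ 2 * n) : 0 ≤ s i := by
  simpa [hankel_apply] using h.hankel_minor_nonneg (m := 1) hi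

theorem IsTotallyNonneg.hankel_sq_le (h : IsTotallyNonneg (hankel s n)) {i : ℕ}
    (hi : i + 4 ≤ 2 * n) : s (i + 1) ^ 2 ≤ s i * s (i + 2) := by
  simpa [Matrix.det_fin_two, hankel_apply, sq] using h.hankel_minor_nonneg (m := 2) hi

theorem IsTotallyNonneg.hankel_eq_zero (h : IsTotallyNonneg (hankel s n)) {i j : ℕ}
    (hi : i + 2 ≤ 2 * n) (hsi : s i = 0) (hj1 : 1 ≤ j) (hj : j + 3 ≤ 2 * n) : s j = 0 := by
  have up (k) (hk : k + 4 ≤ 2 * n) (hsk : s k = 0) : s (k + 1) = 0 :=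
    sq_nonpos_iff _ |>.1 ((h.hankel_sq_le hk).trans_eq (by rw [hsk, zero_mul]))
  have down (k) (hk : k + 4 ≤ 2 * n) (hsk : s (k + 2) = 0) : s (k + 1) = 0 :=
    sq_nonpos_iff _ |>.1 ((h.hankel_sq_le hk).trans_eq (by rw [hsk, mul_zero]))
  obtain hij | hij := le_total i j
  · induction j, hij using Nat.le_induction with
    | base => exact hsi
    | succ j hij ih =>
      refine up j (by omega) ?_
      obtain rfl | hj0 := j.eq_zero_or_pos
      · rwa [Nat.le_zero.1 hij] at hsi
      · exact ih hj0 (by omega)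
  · induction i, hij using Nat.le_induction with
    | base => exact hsi
    | succ i hij ih =>
      obtain ⟨k, rfl⟩ := Nat.exists_eq_add_of_le' (hj1.trans hij)
      exact ih (by omega) (down k (by omega) hsi)

theorem IsTotallyNonneg.hankel_isDiag (h : IsTotallyNonneg (hankel s n)) {i : ℕ}
    (hi : i + 2 ≤ 2 * n) (hsi : s i = 0) : (hankel s n).IsDiag := fun a b hab ↦
  have := Fin.val_ne_of_ne hab
  h.hankel_eq_zero hi hsi (by omega) (by omega)

theorem IsTotallyNonneg.hankel_succ_isDiag (h : IsTotallyNonneg (hankel s n)) {i : ℕ}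
    (hi : i + 2 ≤ 2 * n) (hsi : s i = 0) : (hankel (fun k ↦ s (k + 1)) (n - 1)).IsDiag :=
  fun _ _ _ ↦ h.hankel_eq_zero hi hsi (by omega) (by omega)

theorem entrywise_eq_map {m n : ℕ} (F : ℝ≥0 → ℝ) {A : Matrix (Fin m) (Fin n) ℝ}
    (hA : ∀ i j, 0 ≤ A i j) : entrywise F A hA = A.map (F ∘ Real.toNNReal) := by
  ext i j
  exact congrArg F (Real.toNNReal_of_nonneg (hA i j)).symm

end TotallyNonnegHankel

section Moments

open MeasureTheory ENNReal

variable {s t : ℕ → ℝ}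

theorem mem_momentSet_Ici_iff : s ∈ momentSet (Set.Ici 0) ↔ (∀ k, 0 ≤ s k) ∧
    ∃ ν : Measure ℝ≥0, ∀ k, ∫⁻ x, (x : ℝ≥0∞) ^ k ∂ν = ENNReal.ofReal (s k) := by
  constructor
  · intro hs
    refine ⟨momentSet.term_nonneg hs, ?_⟩
    obtain ⟨μ, hμ, hsμ⟩ := hs
    have hnonneg : ∀ᵐ x ∂μ, 0 ≤ x := mem_ae_iff.mpr hμ.supported
    refine ⟨μ.map Real.toNNReal, fun k ↦ ?_⟩
    rw [lintegral_map (by fun_prop) (by fun_prop), hsμ k,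
      ofReal_integral_eq_lintegral_ofReal (hμ.integrable_pow k)
        (hnonneg.mono fun x hx ↦ pow_nonneg hx k)]
    exact lintegral_congr_ae (hnonneg.mono fun x hx ↦ (ofReal_pow hx k).symm)
  · rintro ⟨hs, ν, hν⟩
    have hlintegral (k : ℕ) : ∫⁻ x : ℝ≥0, ENNReal.ofReal ((x : ℝ) ^ k) ∂ν =
        ENNReal.ofReal (s k) := by
      simpa only [ofReal_pow NNReal.zero_le_coe, ofReal_coe_nnreal] using hν k
    refine ⟨ν.map ((↑) : ℝ≥0 → ℝ), ⟨?_, fun k ↦ ?_⟩, fun k ↦ ?_⟩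
    · rw [Measure.map_apply (by fun_prop) measurableSet_Ici.compl]
      simp [Set.preimage]
    · rw [integrable_map_measure (by fun_prop) (by fun_prop)]
      refine ⟨by fun_prop, ?_⟩
      rw [hasFiniteIntegral_iff_ofReal (.of_forall fun x ↦ by simp)]
      exact (hlintegral k).trans_lt ofReal_lt_top
    · rw [integral_map (by fun_prop) (by fun_prop), integral_eq_lintegral_of_nonneg_ae
        (.of_forall fun x ↦ by simp) (by fun_prop), hlintegral k, toReal_ofReal (hs k)]

theorem geometric_mem_momentSet {u : ℝ} (hu : 0 ≤ u) : (u ^ ·) ∈ momentSet (Set.Ici 0) :=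
  mem_momentSet_Ici_iff.2 ⟨pow_nonneg hu, .dirac u.toNNReal, fun k ↦ by
    rw [lintegral_dirac, ofReal_pow hu, ENNReal.ofReal]⟩

theorem mul_mem_momentSet (hs : s ∈ momentSet (Set.Ici 0)) (ht : t ∈ momentSet (Set.Ici 0)) :
    s * t ∈ momentSet (Set.Ici 0) := by
  obtain ⟨hs0, ν, hν⟩ := mem_momentSet_Ici_iff.1 hs
  obtain ⟨ht0, ρ, hρ⟩ := mem_momentSet_Ici_iff.1 ht
  have : IsFiniteMeasure ρ := ⟨by simpa using (hρ 0).trans_lt ofReal_lt_top⟩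
  refine mem_momentSet_Ici_iff.2 ⟨fun k ↦ mul_nonneg (hs0 k) (ht0 k), ν.mconv ρ, fun k ↦ ?_⟩
  rw [Measure.lintegral_mconv (by fun_prop)]
  simp only [coe_mul, mul_pow, lintegral_const_mul' _ _ (pow_ne_top coe_ne_top)]
  rw [lintegral_mul_const _ (by fun_prop), hν, hρ, ← ofReal_mul (hs0 k), Pi.mul_apply]

theorem pow_mem_momentSet (hs : s ∈ momentSet (Set.Ici 0)) (j : ℕ) :
    s ^ j ∈ momentSet (Set.Ici 0) := by
  induction j with
  | zero => simpa [Pi.one_def] using geometric_mem_momentSet zero_le_one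
  | succ j ih => exact pow_succ s j ▸ mul_mem_momentSet ih hs

theorem hasSum_mem_momentSet {ι : Type*} {c : ι → ℝ} (hc : ∀ i, 0 ≤ c i) {s : ι → ℕ → ℝ}
    (hs : ∀ i, s i ∈ momentSet (Set.Ici 0)) (ht : ∀ k, HasSum (fun i ↦ c i * s i k) (t k)) :
    t ∈ momentSet (Set.Ici 0) := by
  have hterm (i k) : 0 ≤ c i * s i k := mul_nonneg (hc i) (momentSet.term_nonneg (hs i) k)
  choose ν hν using fun i ↦ (mem_momentSet_Ici_iff.1 (hs i)).2
  refine mem_momentSet_Ici_iff.2 ⟨fun k ↦ (ht k).nonneg fun i ↦ hterm i k,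
    .sum fun i ↦ ENNReal.ofReal (c i) • ν i, fun k ↦ ?_⟩
  simp only [lintegral_sum_measure, lintegral_smul_measure, hν, smul_eq_mul, ← ofReal_mul (hc _)]
  rw [← ofReal_tsum_of_nonneg (fun i ↦ hterm i k) (ht k).summable, (ht k).tsum_eq]

theorem twoAtom_mem_momentSet {a b u : ℝ} (ha : 0 ≤ a) (hb : 0 ≤ b) (hu : 0 ≤ u) :
    (fun k ↦ a + b * u ^ k) ∈ momentSet (Set.Ici 0) :=
  hasSum_mem_momentSet (c := ![a, b]) (s := ![(1 ^ ·), (u ^ ·)])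
    (Fin.forall_fin_two.2 ⟨ha, hb⟩)
    (Fin.forall_fin_two.2 ⟨geometric_mem_momentSet zero_le_one, geometric_mem_momentSet hu⟩)
    fun k ↦ by
      simpa using hasSum_fintype fun i ↦ ![a, b] i * (![(1 ^ ·), (u ^ ·)] : Fin 2 → ℕ → ℝ) i k

theorem succ_mem_momentSet (hs : s ∈ momentSet (Set.Ici 0)) :
    (fun k ↦ s (k + 1)) ∈ momentSet (Set.Ici 0) := by
  obtain ⟨hs0, ν, hν⟩ := mem_momentSet_Ici_iff.1 hs
  refine mem_momentSet_Ici_iff.2 ⟨fun k ↦ hs0 _, ν.withDensity (↑), fun k ↦ ?_⟩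
  rw [lintegral_withDensity_eq_lintegral_mul _ (by fun_prop) (by fun_prop), ← hν]
  simp only [Pi.mul_apply, pow_succ']

theorem hankel_posSemidef_of_mem_momentSet {K : Set ℝ} (hs : s ∈ momentSet K) (n : ℕ) :
    (hankel s n).PosSemidef := by
  obtain ⟨μ, hμ, hsμ⟩ := hs
  have hrankOne (x : ℝ) : (hankel (x ^ ·) n).PosSemidef := by
    convert Matrix.posSemidef_vecMulVec_self_star fun i : Fin n ↦ x ^ (i : ℕ) using 1
    ext i j
    simp [hankel_apply, pow_add, Matrix.vecMulVec_apply]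
  convert posSemidef_integral (μ := μ) hrankOne fun i j ↦ hμ.integrable_pow _ using 1
  ext i j
  exact hsμ _

theorem hankel_mem_HTN_of_mem_momentSet (hs : s ∈ momentSet (Set.Ici 0)) (n : ℕ) :
    hankel s n ∈ HTN n :=
  hankel_mem_HTN_iff.2 ⟨hankel_posSemidef_of_mem_momentSet hs n,
    hankel_posSemidef_of_mem_momentSet (succ_mem_momentSet hs) (n - 1)⟩

theorem eq_zero_of_mem_momentSet (hs : s ∈ momentSet (Set.Ici 0)) {i k : ℕ} (hi : s i = 0)
    (hk : 1 ≤ k) : s k = 0 :=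
  (hankel_mem_HTN_of_mem_momentSet hs (i + k + 2)).2.hankel_eq_zero (i := i) (by omega) hi hk
    (by omega)

theorem termwise_apply (F : ℝ≥0 → ℝ) (hs : ∀ k, 0 ≤ s k) (k : ℕ) :
    termwise F s hs k = F (s k).toNNReal :=
  congrArg F (Real.toNNReal_of_nonneg (hs k)).symm

end Moments

section HasAbsMonotonicExpansion

/-- On `(0, ∞)` the function `F` is the sum of a power series with non-negative coefficients `c`,
and `F` may jump downwards at `0`, to a non-negative value. This is condition (4) of the theorem
with the entire function replaced by its Taylor coefficients at `0`. -/
structure HasAbsMonotonicExpansion (F : ℝ≥0 → ℝ) (c : ℕ → ℝ) : Prop where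
  coeff_nonneg : ∀ k, 0 ≤ c k
  hasSum : ∀ x : ℝ≥0, 0 < x → HasSum (fun k ↦ c k * (x : ℝ) ^ k) (F x)
  zero_nonneg : 0 ≤ F 0
  zero_le_coeff : F 0 ≤ c 0

namespace HasAbsMonotonicExpansion

variable {F : ℝ≥0 → ℝ} {c : ℕ → ℝ} {n : ℕ}

theorem zero_le (hF : HasAbsMonotonicExpansion F c) (x : ℝ≥0) : F 0 ≤ F x := by
  obtain rfl | hx := eq_zero_or_pos x
  · exact le_rfl
  · simpa using hF.zero_le_coeff.trans <| (by simp : c 0 ≤ c 0 * (x : ℝ) ^ 0).trans <|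
      le_hasSum (hF.hasSum x hx) 0 fun k _ ↦ mul_nonneg (hF.coeff_nonneg k) (by positivity)

theorem hasSum_toNNReal (hF : HasAbsMonotonicExpansion F c) {x : ℝ} (hx : 0 < x) :
    HasSum (fun k ↦ c k * x ^ k) (F x.toNNReal) := by
  simpa only [Real.coe_toNNReal x hx.le] using hF.hasSum _ (Real.toNNReal_pos.2 hx)

theorem map_posSemidef_of_pos (hF : HasAbsMonotonicExpansion F c)
    {A : Matrix (Fin n) (Fin n) ℝ} (hA : A.PosSemidef) (hpos : ∀ i j, 0 < A i j) :
    (A.map (F ∘ Real.toNNReal)).PosSemidef :=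
  posSemidef_map_of_hasSum hA hF.coeff_nonneg fun i j ↦ hF.hasSum_toNNReal (hpos i j)

theorem map_posSemidef_of_isDiag (hF : HasAbsMonotonicExpansion F c)
    {A : Matrix (Fin n) (Fin n) ℝ} (hA : A.IsDiag) : (A.map (F ∘ Real.toNNReal)).PosSemidef :=
  posSemidef_map_of_isDiag hA (by simpa using hF.zero_nonneg) fun i ↦ by
    simpa using hF.zero_le _

theorem entrywise_mem_HTN (hF : HasAbsMonotonicExpansion F c) {A : Matrix (Fin n) (Fin n) ℝ}
    (hA : A ∈ HTN n) : entrywise F A hA.2.entry_nonneg ∈ HTN n := by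
  obtain ⟨s, rfl⟩ := exists_eq_hankel_of_mem_HTN hA
  rw [entrywise_eq_map, hankel_map, hankel_mem_HTN_iff]
  obtain ⟨hs, hs'⟩ := hankel_mem_HTN_iff.1 hA
  by_cases hpos : ∀ i, i + 2 ≤ 2 * n → 0 < s i
  · exact ⟨hF.map_posSemidef_of_pos hs fun i j ↦ hpos _ (by omega),
      hF.map_posSemidef_of_pos hs' fun i j ↦ hpos _ (by omega)⟩
  · push Not at hpos
    obtain ⟨i, hi, hsi⟩ := hpos
    have hzero : s i = 0 := hsi.antisymm (hA.2.hankel_nonneg hi)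
    exact ⟨hF.map_posSemidef_of_isDiag (hA.2.hankel_isDiag hi hzero),
      hF.map_posSemidef_of_isDiag (hA.2.hankel_succ_isDiag hi hzero)⟩

theorem termwise_mem_momentSet (hF : HasAbsMonotonicExpansion F c) {s : ℕ → ℝ}
    (hs : s ∈ momentSet (Set.Ici 0)) :
    termwise F s (momentSet.term_nonneg hs) ∈ momentSet (Set.Ici 0) := by
  by_cases hpos : ∀ k, 0 < s k
  · refine hasSum_mem_momentSet hF.coeff_nonneg (pow_mem_momentSet hs) fun k ↦ ?_
    rw [termwise_apply]
    exact hF.hasSum_toNNReal (hpos k)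
  · push Not at hpos
    obtain ⟨i, hi⟩ := hpos
    have hzero : s i = 0 := hi.antisymm (momentSet.term_nonneg hs i)
    convert twoAtom_mem_momentSet hF.zero_nonneg
      (sub_nonneg.2 (hF.zero_le (s 0).toNNReal)) le_rfl using 1
    ext k
    obtain _ | k := k
    · simp [termwise_apply]
    · simp [termwise_apply, eq_zero_of_mem_momentSet hs hzero k.succ_pos]

end HasAbsMonotonicExpansion

end HasAbsMonotonicExpansion

section Entire

open Filter
open scoped ComplexOrder Nat

variable {g : ℂ → ℂ}

theorem isAbsMonotonicEntire_iff_iteratedDeriv_zero_nonneg (hg : Differentiable ℂ g) :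
    IsAbsMonotonicEntire g ↔ ∀ n, 0 ≤ iteratedDeriv n g 0 := by
  have hdiff (n : ℕ) : Differentiable ℂ (iteratedDeriv n g) :=
    (hg.contDiff (n := ⊤)).differentiable_iteratedDeriv n (WithTop.coe_lt_top _)
  refine ⟨fun h n ↦ ?_, fun h ↦ ⟨hg, fun x hx n ↦ ?_⟩⟩
  · have hlim : Tendsto (fun x : ℝ ↦ iteratedDeriv n g x) (𝓝[>] 0) (𝓝 (iteratedDeriv n g 0)) :=
      (((hdiff n).continuous.comp Complex.continuous_ofReal).tendsto 0).mono_left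
        nhdsWithin_le_nhds
    exact ge_of_tendsto hlim <| eventually_mem_nhdsWithin.mono fun x hx ↦
      Complex.nonneg_iff.2 ⟨(h.2 x hx n).2, (h.2 x hx n).1.symm⟩
  · have hnonneg : 0 ≤ iteratedDeriv n g x := by
      refine (hdiff n).nonneg_of_iteratedDeriv_nonneg (c := 0) (fun k ↦ ?_)
        (by exact_mod_cast hx.le)
      simpa only [iteratedDeriv_eq_iterate, Function.iterate_add_apply] using h (k + n)
    exact ⟨(Complex.nonneg_iff.1 hnonneg).2.symm, (Complex.nonneg_iff.1 hnonneg).1⟩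

theorem IsAbsMonotonicEntire.hasSum_re (hg : IsAbsMonotonicEntire g) (x : ℝ) :
    HasSum (fun k ↦ (iteratedDeriv k g 0).re / k ! * x ^ k) (g x).re := by
  convert Complex.hasSum_re (Complex.hasSum_taylorSeries_of_entire hg.1 0 x) using 2 with k
  rw [Complex.eq_re_of_ofReal_le (r := 0) (z := iteratedDeriv k g 0)
    (by simpa using (isAbsMonotonicEntire_iff_iteratedDeriv_zero_nonneg hg.1).1 hg k)]
  simp only [sub_zero, smul_eq_mul, ← Complex.ofReal_natCast, ← Complex.ofReal_pow,
    ← Complex.ofReal_inv, ← Complex.ofReal_mul, Complex.ofReal_re]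
  ring

theorem exists_differentiable_hasSum {c : ℕ → ℂ}
    (hc : ∀ r : ℝ≥0, Summable fun k ↦ ‖c k‖ * (r : ℝ) ^ k) :
    ∃ g : ℂ → ℂ, Differentiable ℂ g ∧ (∀ z, HasSum (fun k ↦ c k * z ^ k) (g z)) ∧
      ∀ k, iteratedDeriv k g 0 = k ! * c k := by
  set p := FormalMultilinearSeries.ofScalars ℂ c
  have hradius : p.radius = ⊤ := p.radius_eq_top_of_summable_norm fun r ↦ by
    simpa only [p, FormalMultilinearSeries.ofScalars_norm] using hc r
  have hp : HasFPowerSeriesOnBall p.sum p 0 ⊤ :=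
    hradius ▸ p.hasFPowerSeriesOnBall (hradius ▸ ENNReal.zero_lt_top)
  refine ⟨p.sum, ?_, fun z ↦ ?_, fun k ↦ ?_⟩
  · simpa [differentiableOn_univ] using hp.differentiableOn
  · simpa [p, FormalMultilinearSeries.ofScalars_apply_eq, mul_comm]
      using hp.hasSum (y := z) (by simp)
  · simpa [p, iteratedDeriv_eq_iteratedFDeriv, FormalMultilinearSeries.ofScalars_apply_eq]
      using (hp.factorial_smul 1 k).symm

variable {F : ℝ≥0 → ℝ}

theorem tendsto_nhdsGT_zero_of_eq_ofReal (hg : Continuous g)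
    (hgF : ∀ x : ℝ≥0, 0 < x → (F x : ℂ) = g (x : ℝ)) : Tendsto F (𝓝[>] 0) (𝓝 (g 0).re) := by
  have hcont : Continuous fun x : ℝ≥0 ↦ (g (x : ℝ)).re := by fun_prop
  refine ((hcont.tendsto' 0 _ (by simp)).mono_left nhdsWithin_le_nhds).congr' ?_
  filter_upwards [self_mem_nhdsWithin] with x hx
  rw [← hgF x hx, Complex.ofReal_re]

theorem HasAbsMonotonicExpansion.exists_isAbsMonotonicEntire {c : ℕ → ℝ}
    (hF : HasAbsMonotonicExpansion F c) : ∃ g : ℂ → ℂ, IsAbsMonotonicEntire g ∧ g 0 = c 0 ∧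
      ∀ x : ℝ≥0, 0 < x → (F x : ℂ) = g (x : ℝ) := by
  have hsummable (r : ℝ≥0) : Summable fun k ↦ ‖(c k : ℂ)‖ * (r : ℝ) ^ k := by
    simp only [Complex.norm_real, Real.norm_of_nonneg (hF.coeff_nonneg _)]
    obtain rfl | hr := eq_zero_or_pos r
    · exact summable_of_ne_finset_zero (s := {0}) fun k hk ↦ by simp_all
    · exact (hF.hasSum r hr).summable
  obtain ⟨g, hg, hsum, hderiv⟩ := exists_differentiable_hasSum hsummable
  refine ⟨g, (isAbsMonotonicEntire_iff_iteratedDeriv_zero_nonneg hg).2 fun k ↦ ?_, ?_,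
    fun x hx ↦ ?_⟩
  · rw [hderiv]
    exact mul_nonneg (Nat.cast_nonneg _) (Complex.zero_le_real.2 (hF.coeff_nonneg k))
  · simpa using hderiv 0
  · exact (Complex.hasSum_ofReal.2 (hF.hasSum x hx)).unique (by simpa using hsum (x : ℝ))

theorem exists_hasAbsMonotonicExpansion_iff :
    (∃ c, HasAbsMonotonicExpansion F c) ↔
      (∃ g : ℂ → ℂ, IsAbsMonotonicEntire g ∧ ∀ x : ℝ≥0, 0 < x → (F x : ℂ) = g (x : ℝ)) ∧
        0 ≤ F 0 ∧ ∃ L : ℝ, Tendsto F (𝓝[>] 0) (𝓝 L) ∧ F 0 ≤ L := by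
  constructor
  · rintro ⟨c, hF⟩
    obtain ⟨g, hg, hg0, hgF⟩ := hF.exists_isAbsMonotonicEntire
    exact ⟨⟨g, hg, hgF⟩, hF.zero_nonneg, _,
      tendsto_nhdsGT_zero_of_eq_ofReal hg.1.continuous hgF, by simpa [hg0] using hF.zero_le_coeff⟩
  · rintro ⟨⟨g, hg, hgF⟩, h0, L, hL, hL0⟩
    have hderiv := (isAbsMonotonicEntire_iff_iteratedDeriv_zero_nonneg hg.1).1 hg
    refine ⟨fun k ↦ (iteratedDeriv k g 0).re / k !,
      fun k ↦ div_nonneg (Complex.nonneg_iff.1 (hderiv k)).1 (Nat.cast_nonneg _),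
      fun x hx ↦ ?_, h0, ?_⟩
    · simpa only [← hgF x hx, Complex.ofReal_re] using hg.hasSum_re x
    · rw [tendsto_nhds_unique hL (tendsto_nhdsGT_zero_of_eq_ofReal hg.1.continuous hgF)] at hL0
      simpa using hL0

end Entire

section Bernstein

open Filter
open scoped ContDiff Nat

variable {f : ℝ → ℝ} {a x : ℝ} {n : ℕ}

theorem taylorWithinEval_uIcc_eq_sum (hf : ContDiff ℝ n f) (hax : a ≠ x) :
    taylorWithinEval f n (Set.uIcc a x) a x =
      ∑ k ∈ Finset.range (n + 1), iteratedDeriv k f a / k ! * (x - a) ^ k := by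
  rw [taylor_within_apply]
  refine Finset.sum_congr rfl fun k hk ↦ ?_
  rw [iteratedDerivWithin_eq_iteratedDeriv (uniqueDiffOn_uIcc hax)
    (hf.of_le (by exact_mod_cast Finset.mem_range_succ_iff.1 hk)).contDiffAt Set.left_mem_uIcc,
    smul_eq_mul]
  ring

theorem exists_eq_taylor_sum_add_lagrange_remainder (hf : ContDiff ℝ (n + 1) f) (hax : a < x) :
    ∃ ξ ∈ Set.Ioo a x, f x =
      ∑ k ∈ Finset.range (n + 1), iteratedDeriv k f a / k ! * (x - a) ^ k +
        iteratedDeriv (n + 1) f ξ / (n + 1)! * (x - a) ^ (n + 1) := by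
  obtain ⟨ξ, hξ, h⟩ := taylor_mean_remainder_lagrange_iteratedDeriv hax.ne hf.contDiffOn
  refine ⟨ξ, by rwa [Set.uIoo_of_lt hax] at hξ, ?_⟩
  rw [taylorWithinEval_uIcc_eq_sum (hf.of_le le_self_add) hax.ne, sub_eq_iff_eq_add'] at h
  rw [h, div_mul_eq_mul_div]

theorem iteratedDeriv_nonneg_of_eventually_nonneg (hf : ContDiff ℝ n f)
    (hzero : ∀ k < n, iteratedDeriv k f a = 0) (hpos : ∀ᶠ x in 𝓝[>] a, 0 ≤ f x) :
    0 ≤ iteratedDeriv n f a := by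
  have htaylor (x : ℝ) :
      taylorWithinEval f n Set.univ a x = iteratedDeriv n f a / n ! * (x - a) ^ n := by
    rw [taylor_within_apply, Finset.sum_range_succ, Finset.sum_eq_zero fun k hk ↦ by
      rw [iteratedDerivWithin_univ, hzero k (Finset.mem_range.1 hk), smul_zero],
      iteratedDerivWithin_univ, zero_add, smul_eq_mul]
    ring
  have hlim : Tendsto (fun x ↦ f x / (x - a) ^ n) (𝓝[>] a) (𝓝 (iteratedDeriv n f a / n !)) := by
    have h := ((Real.taylor_tendsto convex_univ (Set.mem_univ a) hf.contDiffOn).mono_left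
      (nhdsWithin_mono a (Set.subset_univ (Set.Ioi a)))).add_const (iteratedDeriv n f a / n !)
    rw [zero_add] at h
    refine h.congr' (eventually_mem_nhdsWithin.mono fun x hx ↦ ?_)
    have hne : (x - a) ^ n ≠ 0 := (pow_pos (sub_pos.2 hx) n).ne'
    rw [htaylor, sub_div, mul_div_cancel_right₀ _ hne, sub_add_cancel]
  have hnonneg : 0 ≤ iteratedDeriv n f a / n ! := ge_of_tendsto hlim <| by
    filter_upwards [hpos, eventually_mem_nhdsWithin] with x hfx hx
    exact div_nonneg hfx (pow_nonneg (sub_nonneg.2 (le_of_lt hx)) n)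
  exact nonneg_of_mul_nonneg_left hnonneg (by positivity)

theorem monotoneOn_iteratedDeriv (hf : ContDiff ℝ ∞ f)
    (hpos : ∀ x, a ≤ x → 0 ≤ iteratedDeriv (n + 1) f x) :
    MonotoneOn (iteratedDeriv n f) (Set.Ici a) := by
  have hdiff : Differentiable ℝ (iteratedDeriv n f) :=
    hf.differentiable_iteratedDeriv n (by exact_mod_cast WithTop.coe_lt_top n)
  refine monotoneOn_of_deriv_nonneg (convex_Ici a) hdiff.continuous.continuousOn
    hdiff.differentiableOn fun y hy ↦ ?_
  rw [← iteratedDeriv_succ]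
  exact hpos y (interior_subset hy)

theorem taylor_sum_le (hf : ContDiff ℝ ∞ f) (hpos : ∀ n x, a ≤ x → 0 ≤ iteratedDeriv n f x)
    (hax : a < x) (n : ℕ) :
    ∑ k ∈ Finset.range (n + 1), iteratedDeriv k f a / k ! * (x - a) ^ k ≤ f x := by
  obtain ⟨ξ, hξ, hfx⟩ := exists_eq_taylor_sum_add_lagrange_remainder (n := n)
    (hf.of_le (by exact_mod_cast le_top)) hax
  have hξ_nonneg := hpos (n + 1) ξ hξ.1.le
  have : 0 < x - a := sub_pos.2 hax
  rw [hfx]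
  exact le_add_of_nonneg_right (by positivity)

theorem taylor_term_le_mul_half_pow (hf : ContDiff ℝ ∞ f)
    (hpos : ∀ n x, a ≤ x → 0 ≤ iteratedDeriv n f x) (hax : a < x) (n : ℕ) :
    iteratedDeriv n f x / n ! * (x - a) ^ n ≤ f (x + 2 * (x - a)) * (1 / 2) ^ n := by
  have : 0 < x - a := sub_pos.2 hax
  have hpos_x (k : ℕ) : 0 ≤ iteratedDeriv k f x := hpos k x hax.le
  have hterm : iteratedDeriv n f x / n ! * (2 * (x - a)) ^ n ≤ f (x + 2 * (x - a)) := by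
    have hsum := taylor_sum_le hf (fun k y hxy ↦ hpos k y (hax.le.trans hxy))
      (show x < x + 2 * (x - a) by linarith) n
    rw [add_sub_cancel_left] at hsum
    exact (Finset.single_le_sum (f := fun k ↦ iteratedDeriv k f x / k ! * (2 * (x - a)) ^ k)
      (fun k _ ↦ mul_nonneg (div_nonneg (hpos_x k) (by positivity)) (by positivity))
      (Finset.self_mem_range_succ n)).trans hsum
  calc
    _ = iteratedDeriv n f x / n ! * (2 * (x - a)) ^ n * (1 / 2) ^ n := by
      rw [mul_assoc, ← mul_pow]
      ring_nf
    _ ≤ _ := by gcongr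

theorem sub_mul_half_pow_le_taylor_sum (hf : ContDiff ℝ ∞ f)
    (hpos : ∀ n x, a ≤ x → 0 ≤ iteratedDeriv n f x) (hax : a < x) (n : ℕ) :
    f x - f (x + 2 * (x - a)) * (1 / 2) ^ (n + 1) ≤
      ∑ k ∈ Finset.range (n + 1), iteratedDeriv k f a / k ! * (x - a) ^ k := by
  obtain ⟨ξ, hξ, hfx⟩ := exists_eq_taylor_sum_add_lagrange_remainder (n := n)
    (hf.of_le (by exact_mod_cast le_top)) hax
  have hderiv_le : iteratedDeriv (n + 1) f ξ ≤ iteratedDeriv (n + 1) f x :=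
    monotoneOn_iteratedDeriv hf (hpos _) hξ.1.le hax.le hξ.2.le
  have hremainder : iteratedDeriv (n + 1) f ξ / (n + 1)! * (x - a) ^ (n + 1) ≤
      f (x + 2 * (x - a)) * (1 / 2) ^ (n + 1) := by
    have : 0 < x - a := sub_pos.2 hax
    exact le_trans (by gcongr) (taylor_term_le_mul_half_pow hf hpos hax (n + 1))
  linarith

theorem hasSum_taylor_of_iteratedDeriv_nonneg (hf : ContDiff ℝ ∞ f)
    (hpos : ∀ n x, a ≤ x → 0 ≤ iteratedDeriv n f x) (hax : a ≤ x) :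
    HasSum (fun k ↦ iteratedDeriv k f a / k ! * (x - a) ^ k) (f x) := by
  obtain rfl | hax := hax.eq_or_lt
  · simpa using hasSum_single (f := fun k ↦ iteratedDeriv k f a / k ! * (a - a) ^ k) 0
      fun k hk ↦ by simp [hk]
  have hterm (k : ℕ) : 0 ≤ iteratedDeriv k f a / k ! * (x - a) ^ k :=
    mul_nonneg (div_nonneg (hpos k a le_rfl) (by positivity)) (pow_nonneg (sub_nonneg.2 hax.le) k)
  rw [hasSum_iff_tendsto_nat_of_nonneg hterm, ← tendsto_add_atTop_iff_nat 1]
  refine tendsto_of_tendsto_of_tendsto_of_le_of_le ?_ tendsto_const_nhds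
    (sub_mul_half_pow_le_taylor_sum hf hpos hax) (taylor_sum_le hf hpos hax)
  have hpow : Tendsto (fun n : ℕ ↦ (1 / 2 : ℝ) ^ (n + 1)) atTop (𝓝 0) :=
    (tendsto_pow_atTop_nhds_zero_of_lt_one (by norm_num) (by norm_num)).comp
      (tendsto_add_atTop_nat 1)
  simpa using (hpow.const_mul (f (x + 2 * (x - a)))).const_sub (f x)

end Bernstein

section Loewner

open scoped ContDiff Matrix

variable {f : ℝ → ℝ}

theorem iteratedDeriv_sum_const_mul_comp_add_mul {ι : Type*} (s : Finset ι) (c y : ι → ℝ) {r : ℕ}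
    (hf : ContDiff ℝ r f) (a : ℝ) :
    iteratedDeriv r (fun b ↦ ∑ i ∈ s, c i * f (a + y i * b)) 0 =
      (∑ i ∈ s, c i * y i ^ r) * iteratedDeriv r f a := by
  have hshift : ContDiff ℝ r fun z ↦ f (a + z) := hf.comp (contDiff_const.add contDiff_id)
  have hterm (i : ι) : iteratedDeriv r (fun b ↦ f (a + y i * b)) 0 =
      y i ^ r * iteratedDeriv r f a := by
    rw [iteratedDeriv_comp_const_mul (f := fun z ↦ f (a + z)) hshift, iteratedDeriv_comp_const_add]
    simp only [mul_zero, add_zero]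
  have hsmooth (i : ι) : ContDiff ℝ r fun b ↦ c i * f (a + y i * b) :=
    contDiff_const.mul (hshift.comp (contDiff_const.mul contDiff_id))
  rw [iteratedDeriv_fun_sum fun i _ ↦ (hsmooth i).contDiffAt, Finset.sum_mul]
  exact Finset.sum_congr rfl fun i _ ↦ by rw [iteratedDeriv_const_mul_field, hterm, mul_assoc]

theorem exists_sum_mul_pow_pow_eq_single {u : ℝ} (hu : 0 < u) (hu1 : u ≠ 1) (m : ℕ) :
    ∃ v : Fin (m + 1) → ℝ, (∀ r < m, ∑ i, v i * (u ^ (i : ℕ)) ^ r = 0) ∧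
      ∑ i, v i * (u ^ (i : ℕ)) ^ m = 1 := by
  set V := Matrix.vandermonde fun i : Fin (m + 1) ↦ u ^ (i : ℕ)
  have hV : IsUnit V.det := isUnit_iff_ne_zero.2 <| Matrix.det_vandermonde_ne_zero_iff.2 <|
    (pow_right_injective₀ hu hu1).comp Fin.val_injective
  have hmul : (Pi.single (Fin.last m) 1 ᵥ* V⁻¹) ᵥ* V = Pi.single (Fin.last m) 1 := by
    rw [Matrix.vecMul_vecMul, Matrix.nonsing_inv_mul V hV, Matrix.vecMul_one]
  refine ⟨Pi.single (Fin.last m) 1 ᵥ* V⁻¹, fun r hr ↦ ?_, ?_⟩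
  · have h := congrFun hmul ⟨r, hr.trans m.lt_succ_self⟩
    rwa [Pi.single_eq_of_ne (Fin.ne_of_lt hr)] at h
  · exact (congrFun hmul (Fin.last m)).trans (Pi.single_eq_same _ _)

-- Loewner: the derivatives in `b` at `0` of the quadratic form at `v` are those of `f` at `a`
-- multiplied by squares, and `v` is chosen so that these vanish up to order `m`.
theorem iteratedDeriv_nonneg_of_hankel_posSemidef {m : ℕ} (hf : ContDiff ℝ m f) {a u : ℝ}
    (hu : 0 < u) (hu1 : u ≠ 1)
    (h : ∀ᶠ b in 𝓝[>] 0, (hankel (fun k ↦ f (a + b * u ^ k)) (m + 1)).PosSemidef) :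
    0 ≤ iteratedDeriv m f a := by
  obtain ⟨v, hv0, hv1⟩ := exists_sum_mul_pow_pow_eq_single hu hu1 m
  set H : ℝ → ℝ := fun b ↦ ∑ p : Fin (m + 1) × Fin (m + 1),
    v p.1 * v p.2 * f (a + u ^ ((p.1 : ℕ) + p.2) * b) with hH
  have hderiv {r : ℕ} (hr : r ≤ m) :
      iteratedDeriv r H 0 = (∑ i, v i * (u ^ (i : ℕ)) ^ r) ^ 2 * iteratedDeriv r f a := by
    rw [hH, iteratedDeriv_sum_const_mul_comp_add_mul _ _ _ (hf.of_le (by exact_mod_cast hr)), sq,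
      Fintype.sum_mul_sum, Fintype.sum_prod_type]
    simp only [pow_add, mul_pow, mul_mul_mul_comm]
  have hsmooth : ContDiff ℝ m H := ContDiff.sum fun p _ ↦
    contDiff_const.mul (hf.comp (contDiff_const.add (contDiff_const.mul contDiff_id)))
  have hpos : ∀ᶠ b in 𝓝[>] 0, 0 ≤ H b := h.mono fun b hb ↦ by
    refine (hb.dotProduct_mulVec_nonneg v).trans_eq ?_
    simp only [hH, dotProduct, Matrix.mulVec, hankel_apply, star_trivial, Finset.mul_sum,
      Fintype.sum_prod_type, mul_comm b]
    exact Finset.sum_congr rfl fun i _ ↦ Finset.sum_congr rfl fun j _ ↦ by ring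
  have hH_nonneg := iteratedDeriv_nonneg_of_eventually_nonneg hsmooth
    (fun r hr ↦ by rw [hderiv hr.le, hv0 r hr]; simp) hpos
  rwa [hderiv le_rfl, hv1, one_pow, one_mul] at hH_nonneg

end Loewner

section Mollification

open MeasureTheory
open scoped ContDiff Convolution

theorem exists_mollifier_support_subset_Ioo {ε : ℝ} (hε : 0 < ε) :
    ∃ w : ℝ → ℝ, ContDiff ℝ ∞ w ∧ HasCompactSupport w ∧ (∀ t, 0 ≤ w t) ∧ ∫ t, w t = 1 ∧
      Function.support w ⊆ Set.Ioo (-ε) 0 := by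
  let φ : ContDiffBump (-(ε / 2)) := ⟨ε / 4, ε / 2, by linarith, by linarith⟩
  refine ⟨φ.normed volume, φ.contDiff_normed, φ.hasCompactSupport_normed, φ.nonneg_normed,
    φ.integral_normed, ?_⟩
  rw [φ.support_normed_eq, Real.ball_eq_Ioo]
  exact Set.Ioo_subset_Ioo (by linarith [show φ.rOut = ε / 2 from rfl])
    (by linarith [show φ.rOut = ε / 2 from rfl])

variable {w G : ℝ → ℝ}

theorem integrable_mul_comp_sub (hw : Continuous w) (hcs : HasCompactSupport w)
    (hG : LocallyIntegrable G) (x : ℝ) : Integrable fun t ↦ w t * G (x - t) :=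
  hcs.convolutionExists_left (.mul ℝ ℝ) hw hG x

theorem contDiff_integral_mul_comp_sub {n : ℕ∞} (hw : ContDiff ℝ n w) (hcs : HasCompactSupport w)
    (hG : LocallyIntegrable G) : ContDiff ℝ n fun x ↦ ∫ t, w t * G (x - t) :=
  hcs.contDiff_convolution_left (.mul ℝ ℝ) hw hG

theorem le_integral_mul_of_forall_mem_support {g : ℝ → ℝ} {c : ℝ} (hw : ∀ t, 0 ≤ w t)
    (hw1 : ∫ t, w t = 1) (hint : Integrable fun t ↦ w t * g t)
    (hg : ∀ t ∈ Function.support w, c ≤ g t) : c ≤ ∫ t, w t * g t := by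
  have hw_int : Integrable w := .of_integral_ne_zero (by simp [hw1])
  calc
    c = ∫ t, w t * c := by rw [integral_mul_const, hw1, one_mul]
    _ ≤ ∫ t, w t * g t := integral_mono (hw_int.mul_const c) hint fun t ↦ by
      by_cases ht : w t = 0
      · simp [ht]
      · exact mul_le_mul_of_nonneg_left (hg t ht) (hw t)

theorem integral_mul_le_of_forall_mem_support {g : ℝ → ℝ} {c : ℝ} (hw : ∀ t, 0 ≤ w t)
    (hw1 : ∫ t, w t = 1) (hint : Integrable fun t ↦ w t * g t)
    (hg : ∀ t ∈ Function.support w, g t ≤ c) : ∫ t, w t * g t ≤ c := by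
  have h := le_integral_mul_of_forall_mem_support (g := -g) (c := -c) hw hw1
    (by simpa using hint.neg) fun t ht ↦ neg_le_neg (hg t ht)
  simpa [integral_neg] using h

end Mollification

section PowerSeriesLimit

open Filter

variable {G : ℝ → ℝ}

theorem continuousOn_Ici_of_hasSum_pow {c : ℕ → ℝ} {g : ℝ → ℝ} (hc : ∀ k, 0 ≤ c k)
    (hg : ∀ x, 0 ≤ x → HasSum (fun k ↦ c k * x ^ k) (g x)) : ContinuousOn g (Set.Ici 0) := by
  obtain ⟨f, hf, hsum, -⟩ := exists_differentiable_hasSum (c := fun k ↦ (c k : ℂ)) fun r ↦ by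
    simpa only [Complex.norm_real, Real.norm_of_nonneg (hc _)] using (hg r r.2).summable
  have hcont : Continuous fun x : ℝ ↦ (f x).re := by have := hf.continuous; fun_prop
  refine hcont.continuousOn.congr fun x hx ↦ ?_
  have hfx : (g x : ℂ) = f x :=
    (Complex.hasSum_ofReal.2 (hg x hx)).unique (by simpa using hsum x)
  exact congrArg Complex.re hfx

-- Since `c n k (2x)ᵏ ≤ M (2x)`, the series at `x` are dominated by a geometric series, so
-- coefficientwise convergence along a subsequence gives convergence of the sums.
theorem exists_subseq_tendsto_hasSum_pow {c : ℕ → ℕ → ℝ} {f : ℕ → ℝ → ℝ} {M : ℝ → ℝ}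
    (hc : ∀ n k, 0 ≤ c n k) (hf : ∀ n x, 0 ≤ x → HasSum (fun k ↦ c n k * x ^ k) (f n x))
    (hM : ∀ n x, 0 ≤ x → f n x ≤ M x) :
    ∃ (d : ℕ → ℝ) (g : ℝ → ℝ) (φ : ℕ → ℕ), StrictMono φ ∧ (∀ k, 0 ≤ d k) ∧
      ∀ x, 0 ≤ x → HasSum (fun k ↦ d k * x ^ k) (g x) ∧
        Tendsto (fun n ↦ f (φ n) x) atTop (𝓝 (g x)) := by
  have hterm_le (n k : ℕ) {x : ℝ} (hx : 0 ≤ x) : c n k * x ^ k ≤ M x :=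
    (le_hasSum (hf n x hx) k fun j _ ↦ mul_nonneg (hc n j) (pow_nonneg hx j)).trans (hM n x hx)
  have hgeom_le (n k : ℕ) {x : ℝ} (hx : 0 ≤ x) : c n k * x ^ k ≤ M (2 * x) * (1 / 2) ^ k := by
    calc
      c n k * x ^ k = c n k * (2 * x) ^ k * (1 / 2) ^ k := by
        rw [mul_assoc, ← mul_pow]
        ring_nf
      _ ≤ M (2 * x) * (1 / 2) ^ k := by
        gcongr
        exact hterm_le n k (by positivity)
  have hgeom (x : ℝ) : Summable fun k : ℕ ↦ M (2 * x) * (1 / 2 : ℝ) ^ k :=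
    summable_geometric_two.mul_left _
  obtain ⟨d, hd, φ, hφ, hlim⟩ := (isCompact_univ_pi (s := fun _ : ℕ ↦ Set.Icc (0 : ℝ) (M 1))
    fun _ ↦ isCompact_Icc).tendsto_subseq (x := c) fun n k _ ↦
      ⟨hc n k, by simpa using hterm_le n k zero_le_one⟩
  have hd0 (k : ℕ) : 0 ≤ d k := (hd k (Set.mem_univ k)).1
  have hlim_term (x : ℝ) (k : ℕ) :
      Tendsto (fun n ↦ c (φ n) k * x ^ k) atTop (𝓝 (d k * x ^ k)) :=
    (tendsto_pi_nhds.1 hlim k).mul_const _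
  refine ⟨d, fun x ↦ ∑' k, d k * x ^ k, φ, hφ, hd0, fun x hx ↦ ⟨?_, ?_⟩⟩
  · exact ((hgeom x).of_nonneg_of_le (fun k ↦ mul_nonneg (hd0 k) (pow_nonneg hx k)) fun k ↦
      le_of_tendsto (hlim_term x k) (.of_forall fun n ↦ hgeom_le (φ n) k hx)).hasSum
  · simp only [← (hf _ x hx).tsum_eq]
    refine tendsto_tsum_of_dominated_convergence (hgeom x) (hlim_term x) (.of_forall fun n k ↦ ?_)
    rw [Real.norm_of_nonneg (mul_nonneg (hc _ k) (pow_nonneg hx k))]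
    exact hgeom_le (φ n) k hx

theorem exists_hasSum_pow_of_tendsto_of_le {c : ℕ → ℕ → ℝ} {f : ℕ → ℝ → ℝ} {ε : ℕ → ℝ}
    (hG : Monotone G) (hc : ∀ n k, 0 ≤ c n k)
    (hf : ∀ n x, 0 ≤ x → HasSum (fun k ↦ c n k * x ^ k) (f n x))
    (hle : ∀ n x, G x ≤ f n x) (hle_add : ∀ n x, f n x ≤ G (x + ε n))
    (hε : Tendsto ε atTop (𝓝 0)) :
    ∃ d : ℕ → ℝ, (∀ k, 0 ≤ d k) ∧ (∀ x, 0 < x → HasSum (fun k ↦ d k * x ^ k) (G x)) ∧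
      G 0 ≤ d 0 := by
  obtain ⟨B, hB⟩ := hε.bddAbove_range
  obtain ⟨d, g, φ, hφ, hd, hg⟩ := exists_subseq_tendsto_hasSum_pow hc hf fun n x _ ↦
    (hle_add n x).trans (hG (add_le_add_right (hB ⟨n, rfl⟩) x))
  have hG_le {x : ℝ} (hx : 0 ≤ x) : G x ≤ g x :=
    ge_of_tendsto (hg x hx).2 (.of_forall fun n ↦ hle (φ n) x)
  have hle_G {x y : ℝ} (hx : 0 ≤ x) (hxy : x < y) : g x ≤ G y := by
    have hlim : Tendsto (fun n ↦ x + ε (φ n)) atTop (𝓝 x) := by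
      simpa using (hε.comp hφ.tendsto_atTop).const_add x
    refine le_of_tendsto (hg x hx).2 ((hlim.eventually_le_const hxy).mono fun n hn ↦ ?_)
    exact (hle_add (φ n) x).trans (hG hn)
  have hcont := continuousOn_Ici_of_hasSum_pow hd fun x hx ↦ (hg x hx).1
  refine ⟨d, hd, fun x hx ↦ ?_, ?_⟩
  · have hlim : Tendsto g (𝓝[<] x) (𝓝 (g x)) :=
      ((hcont.continuousAt (Ici_mem_nhds hx)).tendsto).mono_left nhdsWithin_le_nhds
    have hgG : g x ≤ G x := le_of_tendsto hlim <| by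
      filter_upwards [self_mem_nhdsWithin, mem_nhdsWithin_of_mem_nhds (Ioi_mem_nhds hx)]
        with y hyx hy using hle_G (le_of_lt hy) hyx
    exact hgG.antisymm (hG_le hx.le) ▸ (hg x hx.le).1
  · have hd0 : HasSum (fun k ↦ d k * (0 : ℝ) ^ k) (d 0) := by
      simpa using hasSum_single (f := fun k ↦ d k * (0 : ℝ) ^ k) 0 fun k hk ↦ by simp [hk]
    exact (hG_le le_rfl).trans_eq ((hg 0 le_rfl).1.unique hd0)

end PowerSeriesLimit

/-- `G` preserves positive semidefiniteness of the Hankel matrices of the sequences `a + b u ^ k`,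
the moment sequences of the two-atom measures `a δ₁ + b δᵤ`. -/
def PreservesTwoAtomHankel (G : ℝ → ℝ) : Prop :=
  ∀ a b u : ℝ, 0 ≤ a → 0 ≤ b → 0 ≤ u → ∀ n, (hankel (fun k ↦ G (a + b * u ^ k)) n).PosSemidef

namespace PreservesTwoAtomHankel

open Filter MeasureTheory
open scoped ContDiff Nat

variable {G w : ℝ → ℝ} {F : ℝ≥0 → ℝ}

theorem nonneg (hG : PreservesTwoAtomHankel G) {a : ℝ} (ha : 0 ≤ a) : 0 ≤ G a := by
  simpa [hankel_apply] using (hG a 0 0 ha le_rfl le_rfl 1).diag_nonneg (i := 0)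

-- The `2 × 2` Hankel matrix for `u = 0` has rows `G (a + b), G a` and `G a, G a`.
theorem monotoneOn (hG : PreservesTwoAtomHankel G) : MonotoneOn G (Set.Ici 0) := by
  intro x hx y hy hxy
  have hdet := (hG x (y - x) 0 hx (sub_nonneg.2 hxy) le_rfl 2).det_nonneg
  simp only [Matrix.det_fin_two, hankel_apply, Fin.coe_ofNat_eq_mod, Nat.zero_mod, Nat.one_mod,
    pow_zero, mul_one, mul_zero, add_zero, zero_add, add_sub_cancel, pow_one, ne_eq,
    Nat.reduceAdd, OfNat.ofNat_ne_zero, not_false_eq_true, zero_pow] at hdet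
  obtain h0 | h0 := (hG.nonneg hx).eq_or_lt
  · exact h0 ▸ hG.nonneg hy
  · exact le_of_mul_le_mul_right (sub_nonneg.1 hdet) h0

theorem monotone_comp_toNNReal (hF : PreservesTwoAtomHankel (F ∘ Real.toNNReal)) :
    Monotone (F ∘ Real.toNNReal) := fun x y hxy ↦ by
  simpa only [Function.comp_apply, Real.toNNReal_coe] using
    hF.monotoneOn x.toNNReal.coe_nonneg y.toNNReal.coe_nonneg (Real.toNNReal_le_toNNReal hxy)

-- As `w` is supported on `(-∞, 0]`, only translates of `a` to the right occur.
theorem integral_mul_comp_sub (hG : PreservesTwoAtomHankel G) (hw : ∀ t, 0 ≤ w t)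
    (hsupp : Function.support w ⊆ Set.Iic 0)
    (hint : ∀ x, Integrable fun t ↦ w t * G (x - t)) :
    PreservesTwoAtomHankel fun x ↦ ∫ t, w t * G (x - t) := by
  intro a b u ha hb hu n
  refine posSemidef_integral
    (A := fun t ↦ w t • hankel (fun k ↦ G (a + b * u ^ k - t)) n) (fun t ↦ ?_) fun i j ↦ hint _
  by_cases ht : w t = 0
  · simpa only [ht, zero_smul] using Matrix.PosSemidef.zero
  · simpa only [sub_add_eq_add_sub] using
      (hG (a - t) b u (by linarith [Set.mem_Iic.1 (hsupp ht)]) hb hu n).smul (hw t)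

theorem exists_contDiff_le_le (hG : PreservesTwoAtomHankel G) (hmono : Monotone G) {ε : ℝ}
    (hε : 0 < ε) : ∃ f : ℝ → ℝ, PreservesTwoAtomHankel f ∧ ContDiff ℝ ∞ f ∧
      (∀ x, G x ≤ f x) ∧ ∀ x, f x ≤ G (x + ε) := by
  obtain ⟨w, hw, hcs, hw0, hw1, hsupp⟩ := exists_mollifier_support_subset_Ioo hε
  have hint := integrable_mul_comp_sub hw.continuous hcs hmono.locallyIntegrable
  refine ⟨fun x ↦ ∫ t, w t * G (x - t),
    hG.integral_mul_comp_sub hw0 (hsupp.trans fun t ht ↦ ht.2.le) hint,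
    contDiff_integral_mul_comp_sub hw hcs hmono.locallyIntegrable, fun x ↦ ?_, fun x ↦ ?_⟩
  · exact le_integral_mul_of_forall_mem_support hw0 hw1 (hint x) fun t ht ↦
      hmono (by linarith [(hsupp ht).2])
  · exact integral_mul_le_of_forall_mem_support hw0 hw1 (hint x) fun t ht ↦
      hmono (by linarith [(hsupp ht).1])

theorem iteratedDeriv_nonneg (hG : PreservesTwoAtomHankel G) (hsmooth : ContDiff ℝ ∞ G) (n : ℕ)
    {a : ℝ} (ha : 0 ≤ a) : 0 ≤ iteratedDeriv n G a :=
  iteratedDeriv_nonneg_of_hankel_posSemidef (u := 2) (hsmooth.of_le (by exact_mod_cast le_top))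
    two_pos (by norm_num) <| eventually_mem_nhdsWithin.mono fun b hb ↦
      hG a b 2 ha (le_of_lt hb) zero_le_two (n + 1)

theorem exists_hasSum_pow (hG : PreservesTwoAtomHankel G) (hmono : Monotone G) :
    ∃ c : ℕ → ℝ, (∀ k, 0 ≤ c k) ∧ (∀ x, 0 < x → HasSum (fun k ↦ c k * x ^ k) (G x)) ∧
      G 0 ≤ c 0 := by
  choose f hf hsmooth hle hle_add using fun n : ℕ ↦
    hG.exists_contDiff_le_le hmono (ε := 1 / ((n : ℝ) + 1)) (by positivity)
  have hderiv (n k : ℕ) (x : ℝ) (hx : 0 ≤ x) : 0 ≤ iteratedDeriv k (f n) x :=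
    (hf n).iteratedDeriv_nonneg (hsmooth n) k hx
  refine exists_hasSum_pow_of_tendsto_of_le (c := fun n k ↦ iteratedDeriv k (f n) 0 / k !) hmono
    (fun n k ↦ div_nonneg (hderiv n k 0 le_rfl) (Nat.cast_nonneg _)) (fun n x hx ↦ ?_) hle hle_add
    tendsto_one_div_add_atTop_nhds_zero_nat
  simpa only [sub_zero] using hasSum_taylor_of_iteratedDeriv_nonneg (hsmooth n) (hderiv n) hx

theorem exists_hasAbsMonotonicExpansion (hF : PreservesTwoAtomHankel (F ∘ Real.toNNReal)) :
    ∃ c, HasAbsMonotonicExpansion F c := by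
  obtain ⟨c, hc, hsum, h0⟩ := hF.exists_hasSum_pow hF.monotone_comp_toNNReal
  exact ⟨c, hc, fun x hx ↦ by simpa using hsum x hx, by simpa using hF.nonneg le_rfl,
    by simpa using h0⟩

theorem of_forall_mem_HTN
    (h : ∀ (n : ℕ), 1 ≤ n → ∀ (A : Matrix (Fin n) (Fin n) ℝ) (hA : A ∈ HTN n),
      (entrywise F A hA.2.entry_nonneg).PosSemidef) :
    PreservesTwoAtomHankel (F ∘ Real.toNNReal) := by
  rintro a b u ha hb hu (_ | n)
  · exact .of_dotProduct_mulVec_nonneg (hankel_isHermitian _ 0) fun x ↦ by simp [dotProduct]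
  · have hmem := hankel_mem_HTN_of_mem_momentSet (twoAtom_mem_momentSet ha hb hu) (n + 1)
    have hpsd := h (n + 1) n.succ_pos _ hmem
    rwa [entrywise_eq_map, hankel_map] at hpsd

theorem of_forall_mem_momentSet
    (h : ∀ (s : ℕ → ℝ) (hs : s ∈ momentSet (Set.Ici 0)),
      termwise F s (momentSet.term_nonneg hs) ∈ momentSet (Set.Ici 0)) :
    PreservesTwoAtomHankel (F ∘ Real.toNNReal) := fun a b u ha hb hu n ↦ by
  have hpsd := hankel_posSemidef_of_mem_momentSet (h _ (twoAtom_mem_momentSet ha hb hu)) n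
  rwa [funext (termwise_apply F _)] at hpsd

end PreservesTwoAtomHankel

theorem theorem2p6 (F : ℝ≥0 → ℝ) :
    List.TFAE [
      ∀ (n : ℕ), 1 ≤ n → ∀ (A : Matrix (Fin n) (Fin n) ℝ) (hA : A ∈ HTN n),
        (entrywise F A hA.2.entry_nonneg).PosSemidef,
      ∀ (n : ℕ), 1 ≤ n → ∀ (A : Matrix (Fin n) (Fin n) ℝ) (hA : A ∈ HTN n),
        entrywise F A hA.2.entry_nonneg ∈ HTN n,
      ∀ (s : ℕ → ℝ) (hs : s ∈ momentSet (Set.Ici 0)),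
        termwise F s (momentSet.term_nonneg hs) ∈ momentSet (Set.Ici 0),
      (∃ g : ℂ → ℂ, IsAbsMonotonicEntire g ∧
          ∀ x : ℝ≥0, 0 < x → ((F x : ℝ) : ℂ) = g ((x : ℝ) : ℂ)) ∧
        0 ≤ F 0 ∧ ∃ L : ℝ, Filter.Tendsto F (𝓝[>] 0) (𝓝 L) ∧ F 0 ≤ L] := by
  rw [← exists_hasAbsMonotonicExpansion_iff]
  tfae_have 2 → 1 := fun h n hn A hA ↦ posSemidef_of_mem_HTN (h n hn A hA)
  tfae_have 1 → 4 := fun h ↦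
    (PreservesTwoAtomHankel.of_forall_mem_HTN h).exists_hasAbsMonotonicExpansion
  tfae_have 3 → 4 := fun h ↦
    (PreservesTwoAtomHankel.of_forall_mem_momentSet h).exists_hasAbsMonotonicExpansion
  tfae_have 4 → 2 := fun ⟨_, hF⟩ _ _ _ hA ↦ hF.entrywise_mem_HTN hA
  tfae_have 4 → 3 := fun ⟨_, hF⟩ _ hs ↦ hF.termwise_mem_momentSet hs
  tfae_finish
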